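/- Let $A\subset\mathbb R^2$ be the closed trapezoid with vertices $(0,0),(1,0),(1,\tfrac45),(0,\tfrac65)$, let $\Delta_1$ be the closed triangle with vertices $(0,0),(3,0),(0,\tfrac65)$, and set $$f^+:=\mathcal L^2\llcorner A,\qquad f^-:=\mathcal H^1\llcorner([2,3]\times\{0\}).$$ Call a compact convex set $\Omega\subset\mathbb R^2$ admissible if $A\subset\Omega$ and $[2,3]\times\{0\}\subset\partial\Omega$. An optimal plan is a positive Borel measure $\gamma$ on $\mathbb R^2\times\mathbb R^2$ with marginals $f^+$ and $f^-$ that minimizes $\int|x-y|\,d\gamma$ among all such measures. A transport density from $f^+$ to $f^-$ is a measure $\sigma$ of the form $$\int\varphi\,d\sigma=\int\Big(\int_0^1\varphi((1-t)x+ty)\,|x-y|\,dt\Big)d\gamma(x,y)\qquad(\varphi\ge 0\text{ Borel}),$$ with $\gamma$ an optimal plan. For a Borel set $S$, write $\sigma\in L^p(S)$ if $\sigma\llcorner S$ has a density in $L^p(S)$ with respect to $\mathcal L^2\llcorner S$. Then $f^+$ and $f^-$ both have total mass $1$, admissible sets $\Omega$ exist, and for every admissible $\Omega$ the measure $f^+$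 has a bounded density with respect to $\mathcal L^2\llcorner\Omega$ and $f^-$ has a bounded density with respect to $\mathcal H^1\llcorner\partial\Omega$. There is exactly one transport density $\sigma$ from $f^+$ to $f^-$, and it satisfies: 1. There are $C>0$ and $r_0>0$ such that $\sigma(B_{2r})\ge C\,r^{3/2}$ for all $0<r<r_0$, where $B_\rho$ is the open ball of radius $\rho$ centered at $(2,0)$. 2. $\sigma\notin L^\infty(U)$ for every open neighbourhood $U$ of $(2,0)$; moreover $\sigma\notin L^\infty(\Delta_1)$ and $\sigma\notin L^4(\Delta_1)$. 3. For every $p\in[1,\infty]$, $\sigma\in L^p(\Delta_1)$ if and only if $p<3$; likewise, for every admissible $\Omega$, $\sigma\in L^p(\Omega)$ if and only if $p<3$. -/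

import Mathlib

open MeasureTheory Set
open scoped ENNReal

namespace TransportCounterexample

/-- The Euclidean plane. -/
abbrev Plane : Type := EuclideanSpace ℝ (Fin 2)

/-- `γ ∈ Π(f, g)`: a positive measure on pairs with marginals `f` and `g`. -/
def IsTransportPlan (f g : Measure Plane) (γ : Measure (Plane × Plane)) : Prop :=
  γ.map Prod.fst = f ∧ γ.map Prod.snd = g

/-- `γ` minimizes the Monge cost `∫ |x - y| dγ` among all transport plans from `f` to `g`. -/
def IsOptimalPlan (f g : Measure Plane) (γ : Measure (Plane × Plane)) : Prop :=
  IsTransportPlan f g γ ∧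
    ∀ γ' : Measure (Plane × Plane), IsTransportPlan f g γ' →
      ∫⁻ z, edist z.1 z.2 ∂γ ≤ ∫⁻ z, edist z.1 z.2 ∂γ'

/-- The measure `σ` associated with a plan `γ`, i.e.
`⟨σ, φ⟩ = ∫ dγ(x, y) ∫₀¹ φ((1 - t) x + t y) |x - y| dt`: the image, under
`((x, y), t) ↦ (1 - t) x + t y`, of `|x - y| d(γ ⊗ dt)` on pairs times `[0, 1]`. -/
noncomputable def planDensity (γ : Measure (Plane × Plane)) : Measure Plane :=
  ((γ.prod ((volume : Measure ℝ).restrict (Icc 0 1))).withDensity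
      (fun q => edist q.1.1 q.1.2)).map
    (fun q => (1 - q.2) • q.1.1 + q.2 • q.1.2)

/-- `σ` is a transport density from `f` to `g`: it comes from some optimal plan. -/
def IsTransportDensity (f g σ : Measure Plane) : Prop :=
  ∃ γ : Measure (Plane × Plane), IsOptimalPlan f g γ ∧ σ = planDensity γ

/-- `ν` has a (nonnegative) density in `L^p(μ)` with respect to `μ`. -/
def HasLpDensity (ν μ : Measure Plane) (p : ℝ≥0∞) : Prop :=
  ∃ g : Plane → ℝ, (∀ x, 0 ≤ g x) ∧ MemLp g p μ ∧
    ν = μ.withDensity (fun x => ENNReal.ofReal (g x))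

/-- `σ ∈ L^p(S)`: the restriction of `σ` to `S` has an `L^p` density with respect to the
Lebesgue measure on `S`. -/
def MemLpOn (σ : Measure Plane) (p : ℝ≥0∞) (S : Set Plane) : Prop :=
  HasLpDensity (σ.restrict S) (volume.restrict S) p

/-- The trapezoid `A` with vertices `(0,0), (1,0), (1,4/5), (0,6/5)`. -/
def trapezoid : Set Plane :=
  convexHull ℝ {!₂[0, 0], !₂[1, 0], !₂[1, 4 / 5], !₂[0, 6 / 5]}

/-- The segment `[2,3] × {0}`. -/
def targetSegment : Set Plane := segment ℝ !₂[2, 0] !₂[3, 0]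

/-- The triangle `Δ₁` with vertices `(0,0), (3,0), (0,6/5)`. -/
def triangle : Set Plane := convexHull ℝ {!₂[0, 0], !₂[3, 0], !₂[0, 6 / 5]}

/-- `f⁺`, the Lebesgue measure on the trapezoid. -/
noncomputable def fPlus : Measure Plane := (volume : Measure Plane).restrict trapezoid

/-- `f⁻`, the one-dimensional Hausdorff measure on the segment `[2,3] × {0}`. -/
noncomputable def fMinus : Measure Plane := (Measure.hausdorffMeasure 1).restrict targetSegment

/-- `Ω` is a compact convex domain containing `A` whose boundary contains `[2,3] × {0}`. -/
def IsAdmissibleDomain (Ω : Set Plane) : Prop :=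
  IsCompact Ω ∧ Convex ℝ Ω ∧ trapezoid ⊆ Ω ∧ targetSegment ⊆ frontier Ω

end TransportCounterexample

namespace TransportCounterexample

/-! ### The ray structure -/

/-! Transport runs along segments ending at `(a, 0)`, `2 ≤ a ≤ 3`, with height `slope a * (a - s)`
over the abscissa `s`. The mass of `f⁺` between neighbouring rays must match the length `da` on the
target: `∫₀¹ ∂ₐ(height s a) ds = 1`, that is `(slope a * (a - 1/2))' = 1`. With `slope 2 = 0` this
gives `slope a = (a - 2) / (a - 1/2)`. The rays sweep `Δ₁`, from the axis (`a = 2`) to the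
hypotenuse (`a = 3`), and mass balance (`accum_one`) makes the map along them push `f⁺` to `f⁻`.

A potential on the target whose derivative is minus the cosine of the ray direction makes `|x - y| +
potential y` have its only minimum over the target at the end of the ray through `x` (`cost_lt`).
The potential term integrates to the same constant for every plan, so the map is optimal, and
strictness gives uniqueness of the plan (`eq_optimalPlan`).

In the coordinates `(ξ, a)`, Lebesgue measure on `Δ₁` is `jac ξ a dξ da` and `σ` is `rayMass ξ a dξ
da`, so the density of `σ` is `rayMass / jac` (`sigma_eq`). Here `rayMass` is bounded, and at least
`1` for `ξ ≥ 1`, while `jac` is comparable to `(a - 2) + (a - ξ)`, which vanishes only at the corner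
`ξ = a = 2`. Hence `∫ σ^p` behaves like the integral of a function homogeneous of degree `1 - p` in
two variables, finite exactly when `p < 3`. The concentration bound holds because a rectangle of
sides `r` and `√r` in `(ξ, a)` is squeezed into a ball of radius `2r`. -/

/-- Minus the slope of the transport ray ending at `(a, 0)`. -/
noncomputable def slope (a : ℝ) : ℝ := (a - 2) / (a - 1 / 2)

/-- The derivative of `slope`. -/
noncomputable def slopeDeriv (a : ℝ) : ℝ := (3 / 2) / (a - 1 / 2) ^ 2

/-- The height above `s` of the ray ending at `(a, 0)`. -/
noncomputable def height (s a : ℝ) : ℝ := slope a * (a - s)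

/-- The derivative of `height s`. -/
noncomputable def jac (s a : ℝ) : ℝ := slopeDeriv a * (a - s) + slope a

/-- The mass carried past abscissa `c` by the ray ending at `(a, 0)`, i.e. `∫₀ᶜ jac s a ds`. -/
noncomputable def accum (c a : ℝ) : ℝ := slopeDeriv a * (a * c - c ^ 2 / 2) + slope a * c

/-- Arc length per unit of abscissa on the ray ending at `(a, 0)`. -/
noncomputable def stretch (a : ℝ) : ℝ := √(1 + slope a ^ 2)

/-- The abscissa of the endpoint of the ray through `(s, y)`. -/
noncomputable def foot (s y : ℝ) : ℝ :=
  ((2 + s + y) + √((2 + s + y) ^ 2 - 8 * s - 2 * y)) / 2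

lemma slope_nonneg {a : ℝ} (ha : 2 ≤ a) : 0 ≤ slope a :=
  div_nonneg (by linarith) (by linarith)

lemma slope_lt_one {a : ℝ} (ha : 2 ≤ a) : slope a < 1 := by
  unfold slope; rw [div_lt_one (by linarith)]; linarith

lemma slope_pos {a : ℝ} (ha : 2 < a) : 0 < slope a :=
  div_pos (by linarith) (by linarith)

lemma slopeDeriv_pos {a : ℝ} (ha : 2 ≤ a) : 0 < slopeDeriv a :=
  div_pos (by norm_num) (pow_pos (by linarith) 2)

lemma hasDerivAt_slope {a : ℝ} (ha : 2 ≤ a) : HasDerivAt slope (slopeDeriv a) a := by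
  have h : a - 1 / 2 ≠ 0 := by linarith
  refine (((hasDerivAt_id a).sub_const 2).div ((hasDerivAt_id a).sub_const (1 / 2)) h).congr_deriv ?_
  unfold slopeDeriv; simp only [id]; congr 1; ring

lemma continuousOn_slope : ContinuousOn slope (Ici 2) := fun _ h =>
  (hasDerivAt_slope h).continuousAt.continuousWithinAt

lemma strictMonoOn_slope : StrictMonoOn slope (Ici 2) := by
  intro a ha b hb hab
  simp only [mem_Ici] at ha hb
  unfold slope
  rw [div_lt_div_iff₀ (by linarith) (by linarith)]
  nlinarith

lemma hasDerivAt_height (s : ℝ) {a : ℝ} (ha : 2 ≤ a) : HasDerivAt (height s) (jac s a) a := by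
  refine ((hasDerivAt_slope ha).mul ((hasDerivAt_id a).sub_const s)).congr_deriv ?_
  simp [jac]

lemma slope_three : slope 3 = 2 / 5 := by norm_num [slope]

lemma height_three (s : ℝ) : height s 3 = 2 / 5 * (3 - s) := by rw [height, slope_three]

/-- Only rays with `a > s` pass above abscissa `s`, so the parameter starts at `max 2 s`: the height
vanishes there through `slope` or through `a - s`. -/
lemma height_max {s : ℝ} : height s (max 2 s) = 0 := by
  rcases max_choice 2 s with h | h <;> rw [h] <;> simp [height, slope]

/-- The equation `height s a = y` is the quadratic `a² - (2 + s + y) a + 2s + y/2 = 0`. Since `slope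
a < 1`, `a` is its larger root, which is `foot`. -/
lemma foot_height {s a : ℝ} (ha : 2 ≤ a) (hs : s ≤ a) : foot s (height s a) = a := by
  have h : 2 * a - 1 ≠ 0 := by linarith
  have e : (2 + s + height s a) ^ 2 - 8 * s - 2 * height s a
      = (2 * a - 2 - s - height s a) ^ 2 := by
    unfold height slope; field_simp; ring
  have hn : 0 ≤ 2 * a - 2 - s - height s a := by
    have := slope_lt_one ha
    unfold height
    nlinarith
  rw [foot, e, Real.sqrt_sq hn]; ring

lemma jac_pos {s a : ℝ} (ha : 2 ≤ a) (hs : s < a) : 0 < jac s a :=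
  add_pos_of_pos_of_nonneg (mul_pos (slopeDeriv_pos ha) (by linarith)) (slope_nonneg ha)

lemma image_height {s : ℝ} (hs : s < 3) :
    height s '' Ioo (max 2 s) 3 = Ioo 0 (2 / 5 * (3 - s)) := by
  apply Subset.antisymm
  · rintro _ ⟨a, ⟨h1, h2⟩, rfl⟩
    obtain ⟨h3, h4⟩ := max_lt_iff.1 h1
    refine ⟨mul_pos (slope_pos h3) (by linarith), ?_⟩
    rw [← height_three]
    exact mul_lt_mul'' (strictMonoOn_slope h3.le (by norm_num : (2 : ℝ) ≤ 3) h2) (by linarith)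
      (slope_nonneg h3.le) (by linarith)
  · have hc : ContinuousOn (height s) (Icc (max 2 s) 3) := fun a ha =>
      (hasDerivAt_height s ((le_max_left 2 s).trans ha.1)).continuousAt.continuousWithinAt
    have := intermediate_value_Ioo (max_le (by norm_num) hs.le) hc
    rwa [height_max, height_three] at this

lemma exists_height_eq {s y : ℝ} (hy : y ∈ Icc 0 (2 / 5 * (3 - s))) :
    ∃ a ∈ Icc (2 : ℝ) 3, height s a = y := by
  have hc : ContinuousOn (height s) (Icc 2 3) := fun a ha =>
    (hasDerivAt_height s ha.1).continuousAt.continuousWithinAt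
  have := intermediate_value_Icc (by norm_num) hc
  rw [height_three] at this
  exact this ⟨by simpa [height, slope] using hy.1, hy.2⟩

lemma height_foot {s y : ℝ} (hs : s ≤ 2) (hy : y ∈ Icc 0 (2 / 5 * (3 - s))) :
    foot s y ∈ Icc 2 3 ∧ height s (foot s y) = y := by
  obtain ⟨a, ha, rfl⟩ := exists_height_eq hy
  rw [foot_height ha.1 (hs.trans ha.1)]
  exact ⟨ha, rfl⟩

lemma continuous_foot : Continuous fun p : ℝ × ℝ => foot p.1 p.2 := by
  unfold foot; fun_prop

lemma measurable_slope : Measurable slope := by unfold slope; fun_prop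
lemma measurable_slopeDeriv : Measurable slopeDeriv := by unfold slopeDeriv; fun_prop
lemma measurable_stretch : Measurable stretch := by
  have := measurable_slope; unfold stretch; fun_prop
lemma measurable_height : Measurable fun p : ℝ × ℝ => height p.1 p.2 := by
  have := measurable_slope; unfold height; fun_prop
lemma measurable_jac : Measurable fun p : ℝ × ℝ => jac p.1 p.2 := by
  have := measurable_slope; have := measurable_slopeDeriv; unfold jac; fun_prop
lemma measurable_accum : Measurable fun p : ℝ × ℝ => accum p.1 p.2 := by
  have := measurable_slope; have := measurable_slopeDeriv; unfold accum; fun_prop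

/-- This is the mass balance that dictates `slope`: the left side is the derivative of `slope a * (a
- 1/2) = a - 2`. -/
lemma accum_one {a : ℝ} (ha : 2 ≤ a) : accum 1 a = 1 := by
  have h : 2 * a - 1 ≠ 0 := by linarith
  unfold accum slopeDeriv slope; field_simp; ring

lemma lintegral_jac {c a : ℝ} (hc : 0 ≤ c) (hca : c < a) (ha : 2 ≤ a) :
    ∫⁻ s in Ioo 0 c, ENNReal.ofReal (jac s a) = ENNReal.ofReal (accum c a) := by
  have hcont : Continuous fun s => jac s a := by unfold jac; fun_prop
  have hi : IntegrableOn (fun s => jac s a) (Ioc 0 c) := hcont.integrableOn_Ioc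
  rw [restrict_Ioo_eq_restrict_Ioc, ← ofReal_integral_eq_lintegral_ofReal hi,
    ← intervalIntegral.integral_of_le hc]
  · congr 1
    have : ∀ s ∈ uIcc 0 c, HasDerivAt (fun s => accum s a) (jac s a) s := by
      intro s _
      refine ((((hasDerivAt_id s).const_mul a).sub ((hasDerivAt_pow 2 s).div_const 2)).const_mul
        (slopeDeriv a) |>.add ((hasDerivAt_id s).const_mul (slope a))).congr_deriv ?_
      unfold jac; norm_num
    rw [intervalIntegral.integral_eq_sub_of_hasDerivAt this (hcont.intervalIntegrable _ _)]
    simp [accum]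
  · filter_upwards [ae_restrict_mem measurableSet_Ioc] with s hs
    exact (jac_pos ha (hs.2.trans_lt hca)).le

/-- Change of variables `y = height s a` on a vertical fibre; `foot s` is a left inverse, hence
injectivity. -/
lemma lintegral_fiber {s : ℝ} (hs : s < 3) (ψ : ℝ → ℝ≥0∞) :
    ∫⁻ y in Icc 0 (2 / 5 * (3 - s)), ψ y
      = ∫⁻ a in Ioo (max 2 s) 3, ENNReal.ofReal (jac s a) * ψ (height s a) := by
  rw [← restrict_Ioo_eq_restrict_Icc, ← image_height hs,
    lintegral_image_eq_lintegral_abs_deriv_mul measurableSet_Ioo (f' := jac s)]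
  · refine setLIntegral_congr_fun measurableSet_Ioo fun a ha => ?_
    obtain ⟨h3, h4⟩ := max_lt_iff.1 ha.1
    simp only [abs_of_pos (jac_pos h3.le h4)]
  · intro a ha
    exact (hasDerivAt_height s (max_lt_iff.1 ha.1).1.le).hasDerivWithinAt
  · intro a ha b hb hab
    obtain ⟨h3, h4⟩ := max_lt_iff.1 ha.1
    obtain ⟨h5, h6⟩ := max_lt_iff.1 hb.1
    rw [← foot_height h3.le h4.le, hab, foot_height h5.le h6.le]

/-! ### The plane regions -/

/-- The part over `[0, c]` of the region between the axis and the line from `(0, 6/5)` to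
`(3, 0)`. -/
def strip (c : ℝ) : Set Plane := {x | x 0 ∈ Icc 0 c ∧ x 1 ∈ Icc 0 (2 / 5 * (3 - x 0))}

lemma isClosed_strip (c : ℝ) : IsClosed (strip c) := by
  have h : strip c = {x : Plane | 0 ≤ x 0} ∩ {x | x 0 ≤ c} ∩ ({x | 0 ≤ x 1} ∩
      {x | x 1 ≤ 2 / 5 * (3 - x 0)}) := by
    ext x; simp [strip]
  rw [h]
  refine ((isClosed_le ?_ ?_).inter (isClosed_le ?_ ?_)).inter
    ((isClosed_le ?_ ?_).inter (isClosed_le ?_ ?_)) <;> fun_prop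

lemma convex_strip (c : ℝ) : Convex ℝ (strip c) := by
  rintro x ⟨⟨hx1, hx2⟩, hx3, hx4⟩ y ⟨⟨hy1, hy2⟩, hy3, hy4⟩ a b ha hb hab
  simp only [strip, mem_ofPred_eq, PiLp.add_apply, PiLp.smul_apply, smul_eq_mul, mem_Icc]
  obtain rfl : b = 1 - a := by linarith
  refine ⟨⟨by positivity, by nlinarith⟩, by positivity, by nlinarith⟩

lemma lintegral_plane {ψ : Plane → ℝ≥0∞} (hψ : Measurable ψ) :
    ∫⁻ x, ψ x = ∫⁻ s, ∫⁻ y, ψ !₂[s, y] := by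
  have h1 := (EuclideanSpace.volume_preserving_symm_measurableEquiv_toLp (Fin 2)).symm
  have h2 := (volume_preserving_finTwoArrow ℝ).symm
  have h3 : MeasurePreserving (fun p : ℝ × ℝ => (!₂[p.1, p.2] : Plane)) volume volume := by
    refine ⟨by fun_prop, ?_⟩
    rw [← (h1.comp h2).map_eq]
    congr 1
  rw [← h3.lintegral_comp hψ, Measure.volume_eq_prod]
  exact lintegral_prod _ (hψ.comp h3.measurable).aemeasurable

lemma measurable_pair : Measurable fun p : ℝ × ℝ => (!₂[p.1, p.2] : Plane) := by
  fun_prop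

lemma setLIntegral_strip {c : ℝ} (hc : c ≤ 3) {ψ : Plane → ℝ≥0∞} (hψ : Measurable ψ) :
    ∫⁻ x in strip c, ψ x = ∫⁻ s in Ioo 0 c, ∫⁻ a in Ioo (max 2 s) 3,
      ENNReal.ofReal (jac s a) * ψ !₂[s, height s a] := by
  rw [← lintegral_indicator (isClosed_strip c).measurableSet,
    lintegral_plane (hψ.indicator (isClosed_strip c).measurableSet),
    restrict_Ioo_eq_restrict_Icc, ← lintegral_indicator measurableSet_Icc]
  -- At `s = 3` the fibre degenerates and `lintegral_fiber` does not apply.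
  have hne : ∀ᵐ s : ℝ, s ≠ 3 := by simp [ae_iff]
  refine lintegral_congr_ae ?_
  filter_upwards [hne] with s hs3
  by_cases hs : s ∈ Icc 0 c
  · rw [indicator_of_mem hs,
      ← lintegral_fiber (lt_of_le_of_ne (hs.2.trans hc) hs3) (fun y => ψ !₂[s, y]),
      ← lintegral_indicator measurableSet_Icc]
    refine lintegral_congr fun y => ?_
    by_cases hy : y ∈ Icc 0 (2 / 5 * (3 - s))
    · rw [indicator_of_mem hy, indicator_of_mem]
      exact ⟨hs, hy⟩
    · rw [indicator_of_notMem hy, indicator_of_notMem]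
      exact fun h => hy h.2
  · rw [indicator_of_notMem hs, ← lintegral_zero (α := ℝ) (μ := volume)]
    refine lintegral_congr fun y => ?_
    rw [indicator_of_notMem]
    exact fun h => hs h.1

lemma mem_segment_pair {a b c d t : ℝ} (ht : t ∈ Icc (0 : ℝ) 1) {x : Plane}
    (h0 : x 0 = (1 - t) * a + t * c) (h1 : x 1 = (1 - t) * b + t * d) :
    x ∈ segment ℝ (!₂[a, b] : Plane) !₂[c, d] := by
  refine ⟨1 - t, t, by linarith [ht.2], ht.1, by ring, ?_⟩
  ext i; fin_cases i <;> simp [h0, h1]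

lemma trapezoid_eq : trapezoid = strip 1 := by
  apply Subset.antisymm
  · refine convexHull_min ?_ (convex_strip 1)
    rintro x (rfl | rfl | rfl | rfl) <;> norm_num [strip]
  · rintro x ⟨⟨h1, h2⟩, h3, h4⟩
    have hK : Convex ℝ trapezoid := convex_convexHull ℝ _
    have hm : ∀ p ∈ ({!₂[0, 0], !₂[1, 0], !₂[1, 4 / 5], !₂[0, 6 / 5]} : Set Plane),
        p ∈ trapezoid := fun p hp => subset_convexHull ℝ _ hp
    have hpos : 0 < 2 / 5 * (3 - x 0) := by linarith
    have lo : (!₂[x 0, 0] : Plane) ∈ trapezoid :=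
      hK.segment_subset (hm !₂[0, 0] (by simp)) (hm !₂[1, 0] (by simp))
        (mem_segment_pair (t := x 0) ⟨h1, h2⟩ (by simp) (by simp))
    have hi : (!₂[x 0, 2 / 5 * (3 - x 0)] : Plane) ∈ trapezoid :=
      hK.segment_subset (hm !₂[0, 6 / 5] (by simp)) (hm !₂[1, 4 / 5] (by simp))
        (mem_segment_pair (t := x 0) ⟨h1, h2⟩ (by simp) (by simp; ring))
    refine hK.segment_subset lo hi (mem_segment_pair (t := x 1 / (2 / 5 * (3 - x 0)))
      ⟨by positivity, (div_le_one hpos).2 h4⟩ (by ring) ?_)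
    rw [div_mul_cancel₀ _ hpos.ne']; ring

lemma triangle_eq : triangle = strip 3 := by
  apply Subset.antisymm
  · refine convexHull_min ?_ (convex_strip 3)
    rintro x (rfl | rfl | rfl) <;> norm_num [strip]
  · rintro x ⟨⟨h1, h2⟩, h3, h4⟩
    have hK : Convex ℝ triangle := convex_convexHull ℝ _
    have hm : ∀ p ∈ ({!₂[0, 0], !₂[3, 0], !₂[0, 6 / 5]} : Set Plane),
        p ∈ triangle := fun p hp => subset_convexHull ℝ _ hp
    have lo : (!₂[x 0, 0] : Plane) ∈ triangle :=
      hK.segment_subset (hm !₂[0, 0] (by simp)) (hm !₂[3, 0] (by simp))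
        (mem_segment_pair (t := x 0 / 3) ⟨by positivity, by linarith⟩ (by simp) (by simp))
    have hi : (!₂[x 0, 2 / 5 * (3 - x 0)] : Plane) ∈ triangle :=
      hK.segment_subset (hm !₂[0, 6 / 5] (by simp)) (hm !₂[3, 0] (by simp))
        (mem_segment_pair (t := x 0 / 3) ⟨by positivity, by linarith⟩ (by simp) (by simp; ring))
    -- At the apex the vertical fibre is a single point and its length cannot be divided by.
    rcases h2.eq_or_lt with h2 | h2
    · have : x 1 = 0 := by rw [h2] at h4; linarith
      rw [show x = !₂[x 0, 0] by ext i; fin_cases i <;> simp [this]]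
      exact lo
    have hpos : 0 < 2 / 5 * (3 - x 0) := by linarith
    refine hK.segment_subset lo hi (mem_segment_pair (t := x 1 / (2 / 5 * (3 - x 0)))
      ⟨by positivity, (div_le_one hpos).2 h4⟩ (by ring) ?_)
    rw [div_mul_cancel₀ _ hpos.ne']; ring

lemma mem_targetSegment {y : Plane} : y ∈ targetSegment ↔ y 0 ∈ Icc 2 3 ∧ y 1 = 0 := by
  constructor
  · rintro ⟨a, b, ha, hb, hab, rfl⟩
    simp only [PiLp.add_apply, PiLp.smul_apply, smul_eq_mul, mem_Icc]
    simp
    constructor <;> linarith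
  · rintro ⟨⟨h1, h2⟩, h3⟩
    exact mem_segment_pair (t := y 0 - 2) ⟨by linarith, by linarith⟩ (by ring) (by simp [h3])

end TransportCounterexample

namespace TransportCounterexample

/-! ### The Kantorovich potential -/

/-- The cosine of the angle between the axis and the ray ending at `(t, 0)`, extended by a constant
to `t < 2`. -/
noncomputable def rayCos (t : ℝ) : ℝ := 1 / √(1 + slope (max 2 t) ^ 2)

/-- The Kantorovich potential on the target segment. -/
noncomputable def potential (b : ℝ) : ℝ := -∫ t in (3 : ℝ)..b, rayCos t

lemma continuous_rayCos : Continuous rayCos := by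
  have h : Continuous fun t => slope (max 2 t) :=
    continuousOn_slope.comp_continuous (by fun_prop) fun t => le_max_left 2 t
  unfold rayCos
  refine Continuous.div (by fun_prop) (by fun_prop) fun t => ?_
  positivity

lemma hasDerivAt_potential (b : ℝ) : HasDerivAt potential (-rayCos b) b :=
  (continuous_rayCos.integral_hasStrictDerivAt 3 b).hasDerivAt.neg

lemma continuous_potential : Continuous potential :=
  continuous_iff_continuousAt.2 fun b => (hasDerivAt_potential b).continuousAt

/-- Basing the potential at `3` makes it nonnegative on the target, so `ENNReal.ofReal` does not
truncate it in `augmentedCost`. -/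
lemma potential_nonneg {b : ℝ} (hb : b ≤ 3) : 0 ≤ potential b := by
  rw [potential, ← intervalIntegral.integral_symm]
  exact intervalIntegral.integral_nonneg hb fun t _ => by unfold rayCos; positivity

lemma height_lt_height {s a b : ℝ} (hs : s ≤ 1) (ha : 2 ≤ a) (hab : a < b) :
    height s a < height s b :=
  mul_lt_mul'' (strictMonoOn_slope ha (ha.trans hab.le) hab) (by linarith)
    (slope_nonneg ha) (by linarith)

lemma height_nonneg {s a : ℝ} (ha : 2 ≤ a) (hs : s ≤ a) : 0 ≤ height s a :=
  mul_nonneg (slope_nonneg ha) (by linarith)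

lemma hasDerivAt_cost {s y b : ℝ} (hb : s < b) :
    HasDerivAt (fun b => √((b - s) ^ 2 + y ^ 2) + potential b)
      ((b - s) / √((b - s) ^ 2 + y ^ 2) - rayCos b) b := by
  have h0 : 0 < b - s := by linarith
  have h : (b - s) ^ 2 + y ^ 2 ≠ 0 := by positivity
  refine (((((hasDerivAt_id b).sub_const s).pow 2).add_const (y ^ 2)).sqrt h |>.add
    (hasDerivAt_potential b)).congr_deriv ?_
  simp only [id, Pi.pow_apply]
  field_simp
  ring

lemma cos_lt_cos {u y z : ℝ} (hu : 0 < u) (hy : 0 ≤ y) (hyz : y < z) :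
    u / √(u ^ 2 + z ^ 2) < u / √(u ^ 2 + y ^ 2) := by
  gcongr

lemma rayCos_eq {s b : ℝ} (hb : 2 ≤ b) (hs : s < b) :
    rayCos b = (b - s) / √((b - s) ^ 2 + height s b ^ 2) := by
  have h : 0 < b - s := by linarith
  rw [rayCos, max_eq_right hb, height,
    show (b - s) ^ 2 + (slope b * (b - s)) ^ 2 = (b - s) ^ 2 * (1 + slope b ^ 2) by ring,
    Real.sqrt_mul (by positivity), Real.sqrt_sq h.le]
  field_simp

/-- The derivative in `b` is the cosine of the direction from the source point to `(b, 0)` minus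
that of the ray ending at `b`. For `b < a` the source point lies above the ray of `b`, so the
difference is negative; for `b > a` it lies below and the difference is positive. -/
lemma cost_lt {s a b : ℝ} (hs : s ≤ 1) (ha : a ∈ Icc (2 : ℝ) 3) (hb : b ∈ Icc (2 : ℝ) 3)
    (hne : b ≠ a) :
    √((a - s) ^ 2 + height s a ^ 2) + potential a
      < √((b - s) ^ 2 + height s a ^ 2) + potential b := by
  set f := fun b => √((b - s) ^ 2 + height s a ^ 2) + potential b with hf
  have hcont : ∀ t ∈ Icc (2 : ℝ) 3, ContinuousWithinAt f (Icc (2 : ℝ) 3) t := fun t ht =>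
    (hasDerivAt_cost (by linarith [ht.1])).continuousAt.continuousWithinAt
  rcases lt_or_gt_of_ne hne with h | h
  · have hanti : StrictAntiOn f (Icc 2 a) := by
      refine strictAntiOn_of_deriv_neg (convex_Icc _ _)
        (ContinuousOn.mono hcont (Icc_subset_Icc_right ha.2)) fun t ht => ?_
      rw [interior_Icc] at ht
      have hst : s < t := by linarith [ht.1]
      rw [(hasDerivAt_cost hst).deriv, rayCos_eq ht.1.le hst, sub_neg]
      exact cos_lt_cos (by linarith) (height_nonneg ht.1.le hst.le)
        (height_lt_height hs ht.1.le ht.2)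
    exact hanti ⟨hb.1, h.le⟩ ⟨ha.1, le_rfl⟩ h
  · have hmono : StrictMonoOn f (Icc a 3) := by
      refine strictMonoOn_of_deriv_pos (convex_Icc _ _)
        (ContinuousOn.mono hcont (Icc_subset_Icc_left ha.1)) fun t ht => ?_
      rw [interior_Icc] at ht
      have hst : s < t := by linarith [ht.1, ha.1]
      rw [(hasDerivAt_cost hst).deriv, rayCos_eq (ha.1.trans ht.1.le) hst, sub_pos]
      exact cos_lt_cos (by linarith) (height_nonneg ha.1 (by linarith [ha.1]))
        (height_lt_height hs ha.1 ht.1)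
    exact hmono ⟨le_rfl, ha.2⟩ ⟨h.le, hb.2⟩ h

/-! ### The optimal plan -/

/-- The optimal transport map. -/
noncomputable def transportMap (x : Plane) : Plane := !₂[foot (x 0) (x 1), 0]

lemma measurable_transportMap : Measurable transportMap := by
  have h : Measurable fun x : Plane => foot (x 0) (x 1) :=
    (continuous_foot.comp (f := fun x : Plane => (x 0, x 1)) (by fun_prop)).measurable
  unfold transportMap
  fun_prop

lemma transportMap_mem {x : Plane} (hx : x ∈ trapezoid) : transportMap x ∈ targetSegment := by
  rw [trapezoid_eq] at hx
  rw [mem_targetSegment]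
  exact ⟨(height_foot (by linarith [hx.1.2]) hx.2).1, rfl⟩

lemma dist_target {x y : Plane} (hy : y ∈ targetSegment) :
    dist x y = √((y 0 - x 0) ^ 2 + x 1 ^ 2) := by
  rw [mem_targetSegment] at hy
  rw [EuclideanSpace.dist_eq, Fin.sum_univ_two, hy.2, Real.dist_eq, Real.dist_eq, sq_abs, sq_abs,
    sub_zero, ← neg_sub, neg_sq]

lemma transportMap_cost_lt {x y : Plane} (hx : x ∈ trapezoid) (hy : y ∈ targetSegment)
    (hne : y ≠ transportMap x) :
    dist x (transportMap x) + potential (transportMap x 0) < dist x y + potential (y 0) := by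
  rw [dist_target hy, dist_target (transportMap_mem hx)]
  rw [trapezoid_eq] at hx
  rw [mem_targetSegment] at hy
  obtain ⟨h1, h2⟩ := height_foot (by linarith [hx.1.2]) hx.2
  have := cost_lt (b := y 0) hx.1.2 h1 hy.1 (fun h => hne ?_)
  · rwa [h2] at this
  · ext i; fin_cases i
    · exact h
    · exact hy.2

lemma isClosed_targetSegment : IsClosed targetSegment := by
  have : targetSegment = {y : Plane | 2 ≤ y 0} ∩ ({y | y 0 ≤ 3} ∩ {y | y 1 = 0}) := by
    ext y; simp [mem_targetSegment, and_assoc]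
  rw [this]
  exact (isClosed_le (by fun_prop) (by fun_prop)).inter
    ((isClosed_le (by fun_prop) (by fun_prop)).inter (isClosed_eq (by fun_prop) (by fun_prop)))

lemma fMinus_eq : fMinus = (volume.restrict (Icc (2 : ℝ) 3)).map fun t => (!₂[t, 0] : Plane) := by
  have hiso : Isometry fun t : ℝ => (!₂[t, 0] : Plane) := by
    refine Isometry.of_dist_eq fun s t => ?_
    rw [EuclideanSpace.dist_eq, Fin.sum_univ_two]
    simp [Real.sqrt_sq_eq_abs, Real.dist_eq]
  have hpre : Icc (2 : ℝ) 3 = (fun t : ℝ => (!₂[t, 0] : Plane)) ⁻¹' targetSegment := by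
    ext t; simp [mem_targetSegment]
  have hcl := isClosed_targetSegment.measurableSet
  rw [hpre, ← Measure.restrict_map hiso.continuous.measurable hcl, ← hausdorffMeasure_real,
    hiso.map_hausdorffMeasure (Or.inl zero_le_one), Measure.restrict_restrict hcl,
    inter_eq_self_of_subset_left, fMinus]
  intro y hy
  refine ⟨y 0, ?_⟩
  ext i; fin_cases i
  · rfl
  · exact (mem_targetSegment.1 hy).2.symm

lemma lintegral_fPlus {ψ : Plane → ℝ≥0∞} (hψ : Measurable ψ) :
    ∫⁻ x, ψ x ∂fPlus = ∫⁻ s in Ioo (0 : ℝ) 1, ∫⁻ a in Ioo (2 : ℝ) 3,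
      ENNReal.ofReal (jac s a) * ψ !₂[s, height s a] := by
  rw [fPlus, trapezoid_eq, setLIntegral_strip (by norm_num) hψ]
  refine setLIntegral_congr_fun measurableSet_Ioo fun s hs => ?_
  simp only [max_eq_left (show s ≤ 2 by linarith [hs.2])]

/-- For fixed `a` the test function is constant along the ray, and the remaining integral of `jac`
over `s ∈ (0, 1)` is `accum 1 a = 1`. -/
lemma map_transportMap : fPlus.map transportMap = fMinus := by
  refine Measure.ext_of_lintegral _ fun ψ hψ => ?_
  rw [lintegral_map hψ measurable_transportMap,
    lintegral_fPlus (ψ := fun x => ψ (transportMap x)) (hψ.comp measurable_transportMap),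
    fMinus_eq, lintegral_map hψ (by fun_prop), ← restrict_Ioo_eq_restrict_Icc,
    lintegral_lintegral_swap]
  · refine setLIntegral_congr_fun measurableSet_Ioo fun a ha => ?_
    have h : ∀ s ∈ Ioo (0 : ℝ) 1, ENNReal.ofReal (jac s a) * ψ (transportMap !₂[s, height s a])
        = ENNReal.ofReal (jac s a) * ψ !₂[a, 0] := by
      intro s hs
      have : foot s (height s a) = a := foot_height ha.1.le (by linarith [hs.2, ha.1])
      simp [transportMap, this]
    rw [setLIntegral_congr_fun measurableSet_Ioo h, lintegral_mul_const,
      lintegral_jac zero_le_one (by linarith [ha.1]) ha.1.le, accum_one ha.1.le]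
    · simp
    · exact (measurable_jac.comp (measurable_prodMk_right (y := a))).ennreal_ofReal
  · refine Measurable.aemeasurable ?_
    refine measurable_jac.ennreal_ofReal.mul ?_
    exact (hψ.comp measurable_transportMap).comp
      (measurable_pair.comp (measurable_fst.prodMk measurable_height))

lemma fMinus_univ : fMinus univ = 1 := by
  rw [fMinus_eq, Measure.map_apply (by fun_prop) MeasurableSet.univ]
  norm_num

lemma fPlus_univ : fPlus univ = 1 := by
  rw [← fMinus_univ, ← map_transportMap, Measure.map_apply measurable_transportMap .univ,
    preimage_univ]

instance : IsProbabilityMeasure fPlus := ⟨fPlus_univ⟩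

lemma measurableSet_trapezoid : MeasurableSet trapezoid := by
  rw [trapezoid_eq]; exact (isClosed_strip 1).measurableSet

/-- The optimal plan. -/
noncomputable def optimalPlan : Measure (Plane × Plane) := fPlus.map fun x => (x, transportMap x)

lemma measurable_graph : Measurable fun x : Plane => (x, transportMap x) :=
  measurable_id.prodMk measurable_transportMap

instance : IsProbabilityMeasure optimalPlan :=
  Measure.isProbabilityMeasure_map measurable_graph.aemeasurable

lemma isTransportPlan_optimalPlan : IsTransportPlan fPlus fMinus optimalPlan := by
  constructor
  · rw [optimalPlan, Measure.map_map measurable_fst measurable_graph]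
    exact Measure.map_id
  · rw [optimalPlan, Measure.map_map measurable_snd measurable_graph]
    exact map_transportMap

/-! ### Optimality and uniqueness of the plan -/

lemma ae_mem_of_isTransportPlan {γ : Measure (Plane × Plane)}
    (hγ : IsTransportPlan fPlus fMinus γ) :
    ∀ᵐ z ∂γ, z.1 ∈ trapezoid ∧ z.2 ∈ targetSegment := by
  have h1 : ∀ᵐ x ∂γ.map Prod.fst, x ∈ trapezoid := by
    rw [hγ.1]; exact ae_restrict_mem measurableSet_trapezoid
  have h2 : ∀ᵐ x ∂γ.map Prod.snd, x ∈ targetSegment := by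
    rw [hγ.2]; exact ae_restrict_mem isClosed_targetSegment.measurableSet
  filter_upwards [ae_of_ae_map measurable_fst.aemeasurable h1,
    ae_of_ae_map measurable_snd.aemeasurable h2] with z hz1 hz2 using ⟨hz1, hz2⟩

/-- The transport cost plus the potential of the target point. -/
noncomputable def augmentedCost (z : Plane × Plane) : ℝ≥0∞ :=
  edist z.1 z.2 + ENNReal.ofReal (potential (z.2 0))

lemma measurable_augmentedCost : Measurable augmentedCost := by
  have := continuous_potential.measurable
  unfold augmentedCost
  fun_prop

/-- The potential sees only the second marginal, so all plans acquire the same extra constant. -/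
lemma lintegral_augmentedCost {γ : Measure (Plane × Plane)}
    (hγ : IsTransportPlan fPlus fMinus γ) :
    ∫⁻ z, augmentedCost z ∂γ = ∫⁻ z, edist z.1 z.2 ∂γ
      + ∫⁻ y, ENNReal.ofReal (potential (y 0)) ∂fMinus := by
  have hp := continuous_potential.measurable
  unfold augmentedCost
  rw [lintegral_add_left (by fun_prop), ← hγ.2, lintegral_map (by fun_prop) measurable_snd]

lemma augmentedCost_lt {x y : Plane} (hx : x ∈ trapezoid) (hy : y ∈ targetSegment)
    (hne : y ≠ transportMap x) : augmentedCost (x, transportMap x) < augmentedCost (x, y) := by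
  have h := transportMap_cost_lt hx hy hne
  have h1 := potential_nonneg (mem_targetSegment.1 hy).1.2
  have h2 := potential_nonneg (mem_targetSegment.1 (transportMap_mem hx)).1.2
  simp only [augmentedCost, edist_dist]
  rw [← ENNReal.ofReal_add dist_nonneg h1, ← ENNReal.ofReal_add dist_nonneg h2]
  exact (ENNReal.ofReal_lt_ofReal_iff (by linarith [dist_nonneg (x := x) (y := transportMap x)])).2 h

lemma augmentedCost_le {x y : Plane} (hx : x ∈ trapezoid) (hy : y ∈ targetSegment) :
    augmentedCost (x, transportMap x) ≤ augmentedCost (x, y) := by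
  by_cases h : y = transportMap x
  · rw [h]
  · exact (augmentedCost_lt hx hy h).le

lemma lintegral_augmentedCost_optimalPlan {γ : Measure (Plane × Plane)}
    (hγ : IsTransportPlan fPlus fMinus γ) :
    ∫⁻ z, augmentedCost z ∂optimalPlan = ∫⁻ z, augmentedCost (z.1, transportMap z.1) ∂γ := by
  rw [optimalPlan, lintegral_map measurable_augmentedCost measurable_graph]
  rw [← hγ.1]
  exact lintegral_map (measurable_augmentedCost.comp measurable_graph) measurable_fst

lemma lintegral_potential_ne_top :
    ∫⁻ y, ENNReal.ofReal (potential (y 0)) ∂fMinus ≠ ∞ := by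
  rw [fMinus_eq, lintegral_map (by have := continuous_potential.measurable; fun_prop)
    (by fun_prop)]
  refine (IntegrableOn.setLIntegral_lt_top ?_).ne
  exact continuous_potential.integrableOn_Icc

lemma isOptimalPlan_optimalPlan : IsOptimalPlan fPlus fMinus optimalPlan := by
  refine ⟨isTransportPlan_optimalPlan, fun γ hγ => ?_⟩
  have h : ∫⁻ z, augmentedCost z ∂optimalPlan ≤ ∫⁻ z, augmentedCost z ∂γ := by
    rw [lintegral_augmentedCost_optimalPlan hγ]
    refine lintegral_mono_ae ?_
    filter_upwards [ae_mem_of_isTransportPlan hγ] with z hz using augmentedCost_le hz.1 hz.2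
  rw [lintegral_augmentedCost hγ, lintegral_augmentedCost isTransportPlan_optimalPlan] at h
  exact (ENNReal.add_le_add_iff_right lintegral_potential_ne_top).1 h

lemma lintegral_edist_optimalPlan_ne_top : ∫⁻ z, edist z.1 z.2 ∂optimalPlan ≠ ∞ := by
  have h : ∀ᵐ z ∂optimalPlan, edist z.1 z.2 ≤ ENNReal.ofReal 5 := by
    filter_upwards [ae_mem_of_isTransportPlan isTransportPlan_optimalPlan] with z hz
    obtain ⟨hx, hy⟩ := hz
    rw [edist_dist, dist_target hy]
    rw [trapezoid_eq] at hx
    rw [mem_targetSegment] at hy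
    obtain ⟨⟨h1, h2⟩, h3, h4⟩ := hx
    refine ENNReal.ofReal_le_ofReal (Real.sqrt_le_iff.2 ⟨by norm_num, ?_⟩)
    have h5 : (z.2 0 - z.1 0) ^ 2 ≤ 3 ^ 2 :=
      pow_le_pow_left₀ (by linarith [hy.1.1]) (by linarith [hy.1.2]) 2
    have h6 : z.1 1 ^ 2 ≤ (6 / 5) ^ 2 := pow_le_pow_left₀ h3 (by linarith) 2
    linarith
  refine ((lintegral_mono_ae h).trans_lt ?_).ne
  simp

/-- Equal finite integrals turn the pointwise inequality into an a.e. equality, and strictness of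
the minimum then puts the plan on the graph of `transportMap`. -/
lemma eq_optimalPlan {γ : Measure (Plane × Plane)} (hγ : IsOptimalPlan fPlus fMinus γ) :
    γ = optimalPlan := by
  obtain ⟨hplan, hmin⟩ := hγ
  have hle : (fun z => augmentedCost (z.1, transportMap z.1)) ≤ᵐ[γ] augmentedCost := by
    filter_upwards [ae_mem_of_isTransportPlan hplan] with z hz using augmentedCost_le hz.1 hz.2
  have hint := lintegral_augmentedCost_optimalPlan hplan
  have heq := ae_eq_of_ae_le_of_lintegral_le hle ?_ measurable_augmentedCost.aemeasurable ?_
  · have hT : ∀ᵐ z ∂γ, z = (z.1, transportMap z.1) := by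
      filter_upwards [ae_mem_of_isTransportPlan hplan, heq] with z hz hz'
      refine Prod.ext rfl ?_
      by_contra hne
      exact (augmentedCost_lt hz.1 hz.2 hne).ne hz'
    calc γ = γ.map id := Measure.map_id.symm
      _ = γ.map (fun z => (z.1, transportMap z.1)) := Measure.map_congr hT
      _ = optimalPlan := by
        rw [optimalPlan, ← hplan.1, Measure.map_map measurable_graph measurable_fst]; rfl
  · rw [← hint, lintegral_augmentedCost isTransportPlan_optimalPlan]
    exact ENNReal.add_ne_top.2 ⟨lintegral_edist_optimalPlan_ne_top, lintegral_potential_ne_top⟩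
  · rw [← hint, lintegral_augmentedCost hplan, lintegral_augmentedCost isTransportPlan_optimalPlan]
    exact add_le_add_left (hmin _ isTransportPlan_optimalPlan) _

lemma isTransportDensity_iff {σ : Measure Plane} :
    IsTransportDensity fPlus fMinus σ ↔ σ = planDensity optimalPlan := by
  constructor
  · rintro ⟨γ, hγ, rfl⟩
    rw [eq_optimalPlan hγ]
  · rintro rfl
    exact ⟨_, isOptimalPlan_optimalPlan, rfl⟩

end TransportCounterexample

namespace TransportCounterexample

/-! ### The transport density -/

/-- The transport density. -/
noncomputable def sigma : Measure Plane := planDensity optimalPlan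

lemma stretch_nonneg (a : ℝ) : 0 ≤ stretch a := Real.sqrt_nonneg _

lemma one_le_stretch (a : ℝ) : 1 ≤ stretch a :=
  Real.one_le_sqrt.2 (by nlinarith [sq_nonneg (slope a)])

lemma dist_ray {s a : ℝ} (ha : a ∈ Icc (2 : ℝ) 3) (hs : s ≤ a) :
    dist (!₂[s, height s a] : Plane) !₂[a, 0] = stretch a * (a - s) := by
  have h : 0 ≤ a - s := by linarith
  rw [dist_target (mem_targetSegment.2 ⟨ha, rfl⟩)]
  simp only [Matrix.cons_val_zero, Matrix.cons_val_one, height]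
  rw [show (a - s) ^ 2 + (slope a * (a - s)) ^ 2 = (1 + slope a ^ 2) * (a - s) ^ 2 by ring,
    Real.sqrt_mul (by positivity), Real.sqrt_sq h, stretch]

/-- Reparametrize the segment by its abscissa `ξ = s + t (a - s)`; the length element is `stretch a
dξ`. -/
lemma lintegral_ray {s a : ℝ} (ha : a ∈ Icc (2 : ℝ) 3) (hs : s < a) {φ : Plane → ℝ≥0∞}
    (hφ : Measurable φ) :
    ∫⁻ t in Icc (0 : ℝ) 1, edist (!₂[s, height s a] : Plane) !₂[a, 0] *
        φ ((1 - t) • !₂[s, height s a] + t • !₂[a, 0])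
      = ENNReal.ofReal (stretch a) * ∫⁻ ξ in Ioo s a, φ !₂[ξ, height ξ a] := by
  have h : 0 < a - s := by linarith
  have himg : (fun t => s + t * (a - s)) '' Ioo 0 1 = Ioo s a := by
    ext ξ
    constructor
    · rintro ⟨t, ⟨h1, h2⟩, rfl⟩
      constructor <;> nlinarith
    · rintro ⟨h1, h2⟩
      refine ⟨(ξ - s) / (a - s), ⟨div_pos (by linarith) h, (div_lt_one h).2 (by linarith)⟩, ?_⟩
      field_simp
      ring
  have hm : Measurable fun ξ : ℝ => φ !₂[ξ, height ξ a] :=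
    hφ.comp (measurable_pair.comp (measurable_id.prodMk (measurable_height.comp
      measurable_prodMk_right)))
  rw [← lintegral_const_mul _ hm, ← himg,
    lintegral_image_eq_lintegral_abs_deriv_mul measurableSet_Ioo (f' := fun _ => a - s),
    ← restrict_Ioo_eq_restrict_Icc]
  · refine lintegral_congr fun t => ?_
    rw [edist_dist, dist_ray ha hs.le, abs_of_pos h, ENNReal.ofReal_mul (stretch_nonneg a),
      mul_comm (ENNReal.ofReal (stretch a)), mul_assoc]
    congr 3
    ext i
    fin_cases i
    · simp; ring
    · simp [height]; ring
  · intro t _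
    exact (((hasDerivAt_id t).mul_const (a - s)).const_add s |>.congr_deriv
      (by ring)).hasDerivWithinAt
  · intro t _ t' _ htt
    exact mul_right_cancel₀ h.ne' (add_left_cancel htt)

lemma lintegral_planDensity {φ : Plane → ℝ≥0∞} (hφ : Measurable φ) :
    ∫⁻ x, φ x ∂sigma = ∫⁻ x, (∫⁻ t in Icc (0 : ℝ) 1, edist x (transportMap x) *
      φ ((1 - t) • x + t • transportMap x)) ∂fPlus := by
  have h1 : Measurable fun q : (Plane × Plane) × ℝ => (1 - q.2) • q.1.1 + q.2 • q.1.2 := by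
    fun_prop
  have h2 : Measurable fun q : (Plane × Plane) × ℝ => edist q.1.1 q.1.2 := by fun_prop
  rw [sigma, planDensity, lintegral_map hφ h1]
  refine (lintegral_withDensity_eq_lintegral_mul _ h2 (hφ.comp h1)).trans ?_
  rw [lintegral_prod _ (h2.mul (hφ.comp h1)).aemeasurable, optimalPlan,
    lintegral_map (h2.mul (hφ.comp h1)).lintegral_prod_right' measurable_graph]
  rfl

/-- The density of `sigma` in the coordinates `(ξ, a)`. -/
noncomputable def rayMass (ξ a : ℝ) : ℝ := stretch a * accum (min 1 ξ) a

/-- The flow through the point of abscissa `ξ` on the ray of `a` comes from the sources with `s <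
min 1 ξ`, whose masses `jac s a` add up to `accum (min 1 ξ) a`. -/
lemma lintegral_sigma {φ : Plane → ℝ≥0∞} (hφ : Measurable φ) :
    ∫⁻ x, φ x ∂sigma = ∫⁻ ξ in Ioo (0 : ℝ) 3, ∫⁻ a in Ioo (max 2 ξ) 3,
      ENNReal.ofReal (rayMass ξ a) * φ !₂[ξ, height ξ a] := by
  have hm : Measurable fun x : Plane => ∫⁻ t in Icc (0 : ℝ) 1, edist x (transportMap x) *
      φ ((1 - t) • x + t • transportMap x) := by
    have := measurable_transportMap
    refine Measurable.lintegral_prod_right' (f := fun q : Plane × ℝ => edist q.1 (transportMap q.1) *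
      φ ((1 - q.2) • q.1 + q.2 • transportMap q.1)) ?_
    fun_prop
  -- The constraint `s < ξ < a` is put into an indicator so that Tonelli can reorder three integrals
  -- over a fixed box.
  set H : ℝ → ℝ → ℝ → ℝ≥0∞ := fun s a ξ => (Ioo s a).indicator (fun ξ =>
    ENNReal.ofReal (jac s a) * (ENNReal.ofReal (stretch a) * φ !₂[ξ, height ξ a])) ξ with hH
  have hφm : Measurable fun p : ℝ × ℝ => φ !₂[p.1, height p.1 p.2] :=
    hφ.comp (measurable_pair.comp (measurable_fst.prodMk measurable_height))
  have hHm : Measurable fun q : ℝ × ℝ × ℝ => H q.1 q.2.1 q.2.2 := by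
    have hset : MeasurableSet {q : ℝ × ℝ × ℝ | q.2.2 ∈ Ioo q.1 q.2.1} :=
      (measurableSet_lt measurable_fst measurable_snd.snd).inter
        (measurableSet_lt measurable_snd.snd measurable_snd.fst)
    have hf : Measurable fun q : ℝ × ℝ × ℝ => ENNReal.ofReal (jac q.1 q.2.1) *
        (ENNReal.ofReal (stretch q.2.1) * φ !₂[q.2.2, height q.2.2 q.2.1]) :=
      (measurable_jac.comp (measurable_fst.prodMk measurable_snd.fst)).ennreal_ofReal.mul
        ((measurable_stretch.comp measurable_snd.fst).ennreal_ofReal.mul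
          (hφm.comp (measurable_snd.snd.prodMk measurable_snd.fst)))
    exact hf.indicator hset
  calc ∫⁻ x, φ x ∂sigma
      = ∫⁻ s in Ioo (0 : ℝ) 1, ∫⁻ a in Ioo (2 : ℝ) 3, ∫⁻ ξ in Ioo (0 : ℝ) 3, H s a ξ := by
        rw [lintegral_planDensity hφ, lintegral_fPlus hm]
        refine setLIntegral_congr_fun measurableSet_Ioo fun s hs => ?_
        refine setLIntegral_congr_fun measurableSet_Ioo fun a ha => ?_
        have hsa : s < a := by linarith [hs.2, ha.1]
        have hfoot : transportMap !₂[s, height s a] = !₂[a, 0] := by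
          have : foot s (height s a) = a := foot_height ha.1.le hsa.le
          simp [transportMap, this]
        have hm' : Measurable fun ξ : ℝ => φ !₂[ξ, height ξ a] :=
          hφm.comp measurable_prodMk_right
        simp only [hfoot, hH]
        rw [lintegral_ray ⟨ha.1.le, ha.2.le⟩ hsa hφ, setLIntegral_indicator measurableSet_Ioo,
          inter_eq_self_of_subset_left (Ioo_subset_Ioo hs.1.le ha.2.le),
          lintegral_const_mul _ (hm'.const_mul _), lintegral_const_mul _ hm']
    _ = ∫⁻ ξ in Ioo (0 : ℝ) 3, ∫⁻ a in Ioo (2 : ℝ) 3, ∫⁻ s in Ioo (0 : ℝ) 1, H s a ξ := by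
        rw [lintegral_congr fun s => lintegral_lintegral_swap
          (hHm.comp measurable_prodMk_left).aemeasurable, lintegral_lintegral_swap]
        · refine lintegral_congr fun ξ => lintegral_lintegral_swap ?_
          exact (hHm.comp (measurable_fst.prodMk
            (measurable_snd.prodMk measurable_const))).aemeasurable
        · refine Measurable.aemeasurable ?_
          refine Measurable.lintegral_prod_right'
            (f := fun q : (ℝ × ℝ) × ℝ => H q.1.1 q.2 q.1.2) ?_
          exact hHm.comp (measurable_fst.fst.prodMk (measurable_snd.prodMk measurable_fst.snd))
    _ = _ := by
        refine setLIntegral_congr_fun measurableSet_Ioo fun ξ hξ => ?_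
        rw [max_comm, ← Ioi_inter_Ioo, ← setLIntegral_indicator measurableSet_Ioi]
        refine setLIntegral_congr_fun measurableSet_Ioo fun a ha => ?_
        by_cases hξa : ξ < a
        · rw [indicator_of_mem (show a ∈ Ioi ξ from hξa)]
          have : ∀ s, H s a ξ = (Iio ξ).indicator (fun s => ENNReal.ofReal (jac s a) *
              (ENNReal.ofReal (stretch a) * φ !₂[ξ, height ξ a])) s := by
            intro s
            by_cases hs : s < ξ
            · rw [indicator_of_mem (show s ∈ Iio ξ from hs), hH]
              exact indicator_of_mem (show ξ ∈ Ioo s a from ⟨hs, hξa⟩) _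
            · rw [indicator_of_notMem (show s ∉ Iio ξ from hs), hH]
              exact indicator_of_notMem (fun h => hs h.1) _
          rw [lintegral_congr this, setLIntegral_indicator measurableSet_Iio, inter_comm,
            Ioo_inter_Iio, lintegral_mul_const, lintegral_jac _ _ ha.1.le, rayMass,
            ENNReal.ofReal_mul (stretch_nonneg a), ← mul_assoc, mul_comm (ENNReal.ofReal _)]
          · exact le_min zero_le_one hξ.1.le
          · exact (min_le_right _ _).trans_lt hξa
          · exact (measurable_jac.comp measurable_prodMk_right).ennreal_ofReal
        · rw [indicator_of_notMem (show a ∉ Ioi ξ from hξa), ← lintegral_zero (α := ℝ)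
            (μ := volume.restrict (Ioo 0 1))]
          refine lintegral_congr fun s => ?_
          exact indicator_of_notMem (fun h => hξa h.2) _

/-- The transport density as a function on the plane. -/
noncomputable def density (x : Plane) : ℝ :=
  (strip 3).indicator (fun x => |rayMass (x 0) (foot (x 0) (x 1)) / jac (x 0) (foot (x 0) (x 1))|) x

/-- The absolute value in `density` secures nonnegativity at every point; on the open rays the
quotient is already nonnegative. -/
lemma density_nonneg (x : Plane) : 0 ≤ density x :=
  indicator_nonneg (fun _ _ => abs_nonneg _) x

lemma measurable_rayMass : Measurable fun p : ℝ × ℝ => rayMass p.1 p.2 := by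
  have h := measurable_accum.comp (f := fun p : ℝ × ℝ => (min 1 p.1, p.2)) (by fun_prop)
  exact (measurable_stretch.comp measurable_snd).mul h

lemma measurable_density : Measurable density := by
  have hc : Measurable fun x : Plane => (x 0, foot (x 0) (x 1)) :=
    ((by fun_prop : Continuous fun x : Plane => x 0).prodMk
      (continuous_foot.comp (f := fun x : Plane => (x 0, x 1)) (by fun_prop))).measurable
  exact ((measurable_rayMass.comp hc).div (measurable_jac.comp hc)).abs.indicator
    (isClosed_strip 3).measurableSet

lemma rayMass_nonneg {ξ a : ℝ} (hξ : 0 ≤ ξ) (ha : 2 ≤ a) : 0 ≤ rayMass ξ a := by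
  have h1 : 0 ≤ min 1 ξ := le_min zero_le_one hξ
  have h2 : min 1 ξ ≤ 1 := min_le_left _ _
  refine mul_nonneg (stretch_nonneg a) (add_nonneg (mul_nonneg (slopeDeriv_pos ha).le ?_)
    (mul_nonneg (slope_nonneg ha) h1))
  nlinarith

lemma density_ray {ξ a : ℝ} (hξ : ξ ∈ Ioo (0 : ℝ) 3) (ha : a ∈ Ioo (max 2 ξ) 3) :
    density !₂[ξ, height ξ a] = rayMass ξ a / jac ξ a := by
  obtain ⟨h1, h2⟩ := max_lt_iff.1 ha.1
  have hm : height ξ a ∈ Ioo 0 (2 / 5 * (3 - ξ)) := by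
    rw [← image_height hξ.2]; exact mem_image_of_mem _ ha
  rw [density, indicator_of_mem]
  · simp only [Matrix.cons_val_zero, Matrix.cons_val_one]
    rw [foot_height h1.le h2.le,
      abs_of_nonneg (div_nonneg (rayMass_nonneg hξ.1.le h1.le) (jac_pos h1.le h2).le)]
  · exact ⟨⟨hξ.1.le, hξ.2.le⟩, hm.1.le, hm.2.le⟩

lemma sigma_eq : sigma = volume.withDensity fun x => ENNReal.ofReal (density x) := by
  have hd := measurable_density.ennreal_ofReal
  refine Measure.ext_of_lintegral _ fun φ hφ => ?_
  rw [lintegral_withDensity_eq_lintegral_mul _ hd hφ, lintegral_sigma hφ,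
    ← setLIntegral_eq_of_support_subset (s := strip 3), setLIntegral_strip le_rfl (hd.mul hφ)]
  · refine setLIntegral_congr_fun measurableSet_Ioo fun ξ hξ => ?_
    refine setLIntegral_congr_fun measurableSet_Ioo fun a ha => ?_
    have hj := jac_pos (max_lt_iff.1 ha.1).1.le (max_lt_iff.1 ha.1).2
    simp only [Pi.mul_apply]
    rw [density_ray hξ ha, ← mul_assoc, ← ENNReal.ofReal_mul hj.le, mul_div_cancel₀ _ hj.ne']
  · intro x hx
    by_contra h
    simp [density, h] at hx

end TransportCounterexample

namespace TransportCounterexample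

/-! ### Summability of the density -/

lemma stretch_le_two {a : ℝ} (ha : 2 ≤ a) : stretch a ≤ 2 := by
  refine Real.sqrt_le_iff.2 ⟨by norm_num, ?_⟩
  nlinarith [slope_nonneg ha, slope_lt_one ha]

lemma rayMass_le_two {ξ a : ℝ} (hξ : 0 ≤ ξ) (ha : 2 ≤ a) : rayMass ξ a ≤ 2 := by
  have h1 : 0 ≤ min 1 ξ := le_min zero_le_one hξ
  have h2 : min 1 ξ ≤ 1 := min_le_left _ _
  have h3 : accum (min 1 ξ) a ≤ 1 := by
    refine le_of_le_of_eq ?_ (accum_one ha)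
    refine add_le_add (mul_le_mul_of_nonneg_left ?_ (slopeDeriv_pos ha).le)
      (mul_le_mul_of_nonneg_left h2 (slope_nonneg ha))
    nlinarith
  unfold rayMass
  nlinarith [stretch_le_two ha, stretch_nonneg a]

/-- Past abscissa `1` a ray has collected all its mass, so only the factor `stretch a` is left. -/
lemma one_le_rayMass {ξ a : ℝ} (hξ : 1 ≤ ξ) (ha : 2 ≤ a) : 1 ≤ rayMass ξ a := by
  rw [rayMass, min_eq_left hξ, accum_one ha, mul_one]
  exact one_le_stretch a

/-- `slopeDeriv` is decreasing: `6/25` is its value at `3`, and the `2/3` of the upper bound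
`jac_le` is its value at `2`. As `slope 2 = 0`, the same constants bound `slope a / (a - 2)`. -/
lemma le_jac {ξ a : ℝ} (ha : a ∈ Ioo (2 : ℝ) 3) (hξ : ξ < a) :
    6 / 25 * ((a - 2) + (a - ξ)) ≤ jac ξ a := by
  have h0 : 0 < a - 1 / 2 := by linarith [ha.1]
  have h1 : 6 / 25 ≤ slopeDeriv a := by
    rw [slopeDeriv, le_div_iff₀ (by positivity)]
    nlinarith [ha.1, ha.2]
  have h2 : 6 / 25 * (a - 2) ≤ slope a := by
    rw [slope, le_div_iff₀ h0]
    nlinarith [ha.1, ha.2]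
  unfold jac
  nlinarith

lemma jac_le {ξ a : ℝ} (ha : 2 ≤ a) (hξ : ξ < a) :
    jac ξ a ≤ 2 / 3 * ((a - 2) + (a - ξ)) := by
  have h0 : 0 < a - 1 / 2 := by linarith
  have h1 : slopeDeriv a ≤ 2 / 3 := by
    rw [slopeDeriv, div_le_iff₀ (by positivity)]
    nlinarith
  have h2 : slope a ≤ 2 / 3 * (a - 2) := by
    rw [slope, div_le_iff₀ h0]
    nlinarith
  unfold jac
  nlinarith

lemma lintegral_density_rpow {p : ℝ} (hp : 0 ≤ p) :
    ∫⁻ x in strip 3, ENNReal.ofReal (density x) ^ p = ∫⁻ ξ in Ioo (0 : ℝ) 3,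
      ∫⁻ a in Ioo (max 2 ξ) 3, ENNReal.ofReal (jac ξ a * (rayMass ξ a / jac ξ a) ^ p) := by
  rw [setLIntegral_strip le_rfl (measurable_density.ennreal_ofReal.pow_const p)]
  refine setLIntegral_congr_fun measurableSet_Ioo fun ξ hξ => ?_
  refine setLIntegral_congr_fun measurableSet_Ioo fun a ha => ?_
  obtain ⟨h1, h2⟩ := max_lt_iff.1 ha.1
  have hj := jac_pos h1.le h2
  rw [density_ray hξ ha, ENNReal.ofReal_mul hj.le, ENNReal.ofReal_rpow_of_nonneg
    (div_nonneg (rayMass_nonneg hξ.1.le h1.le) hj.le) hp]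

/-- The inequality between arithmetic and geometric means bounds `jac` below by a product, which
separates the singularities in `a - 2` and `a - ξ`. -/
lemma integrand_le {ξ a p : ℝ} (hp : 1 ≤ p) (hξ : 0 ≤ ξ) (ha : a ∈ Ioo (2 : ℝ) 3) (hξa : ξ < a) :
    jac ξ a * (rayMass ξ a / jac ξ a) ^ p
      ≤ (2 ^ p * (6 / 25) ^ (1 - p)) * ((a - 2) ^ ((1 - p) / 2) * (a - ξ) ^ ((1 - p) / 2)) := by
  have hj := jac_pos ha.1.le hξa
  have hα : 0 < a - 2 := by linarith [ha.1]
  have hβ : 0 < a - ξ := by linarith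
  have hle : 6 / 25 * (√(a - 2) * √(a - ξ)) ≤ jac ξ a := by
    refine le_trans ?_ (le_jac ha hξa)
    nlinarith [Real.sq_sqrt hα.le, Real.sq_sqrt hβ.le, sq_nonneg (√(a - 2) - √(a - ξ)),
      mul_nonneg (Real.sqrt_nonneg (a - 2)) (Real.sqrt_nonneg (a - ξ))]
  have hr := rayMass_nonneg hξ ha.1.le
  calc jac ξ a * (rayMass ξ a / jac ξ a) ^ p
      = rayMass ξ a ^ p * jac ξ a ^ (1 - p) := by
        rw [Real.div_rpow hr hj.le, Real.rpow_sub hj, Real.rpow_one]; ring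
    _ ≤ 2 ^ p * (6 / 25 * (√(a - 2) * √(a - ξ))) ^ (1 - p) :=
        mul_le_mul (Real.rpow_le_rpow hr (rayMass_le_two hξ ha.1.le) (by linarith))
          (Real.rpow_le_rpow_of_nonpos (by positivity) hle (by linarith)) (by positivity)
          (by positivity)
    _ = _ := by
        rw [Real.mul_rpow (by norm_num) (by positivity), Real.mul_rpow (by positivity)
          (by positivity), Real.sqrt_eq_rpow, Real.sqrt_eq_rpow, ← Real.rpow_mul hα.le,
          ← Real.rpow_mul hβ.le, mul_assoc, show 1 / 2 * (1 - p) = (1 - p) / 2 by ring]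

/-- After enlarging the domain, integrating in `ξ` first leaves a product of two copies of `∫₀³
u^((1 - p)/2) du`, finite because `(1 - p)/2 > -1` for `p < 3`. -/
lemma lintegral_density_rpow_lt_top {p : ℝ} (hp : 1 ≤ p) (hp3 : p < 3) :
    ∫⁻ x in strip 3, ENNReal.ofReal (density x) ^ p < ∞ := by
  set f : ℝ → ℝ≥0∞ := (Ioo (0 : ℝ) 3).indicator fun u => ENNReal.ofReal (u ^ ((1 - p) / 2)) with hf
  have hfm : Measurable f := by
    refine Measurable.indicator ?_ measurableSet_Ioo
    fun_prop
  have hI : ∫⁻ u, f u < ∞ := by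
    rw [lintegral_indicator measurableSet_Ioo, restrict_Ioo_eq_restrict_Ioc]
    refine IntegrableOn.setLIntegral_lt_top ?_
    exact (intervalIntegrable_iff_integrableOn_Ioc_of_le (by norm_num)).1
      (intervalIntegral.intervalIntegrable_rpow' (by linarith))
  set C : ℝ := 2 ^ p * (6 / 25) ^ (1 - p) with hC
  have hC0 : 0 ≤ C := by positivity
  rw [lintegral_density_rpow (by linarith)]
  calc _ ≤ ∫⁻ ξ in Ioo (0 : ℝ) 3, ∫⁻ a in Ioo (max 2 ξ) 3,
        ENNReal.ofReal C * (f (a - 2) * f (a - ξ)) := by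
        refine setLIntegral_mono' measurableSet_Ioo fun ξ hξ => ?_
        refine setLIntegral_mono' measurableSet_Ioo fun a ha => ?_
        obtain ⟨h1, h2⟩ := max_lt_iff.1 ha.1
        rw [hf, indicator_of_mem (show a - 2 ∈ Ioo 0 3 from ⟨by linarith, by linarith [ha.2]⟩),
          indicator_of_mem (show a - ξ ∈ Ioo 0 3 from ⟨by linarith, by linarith [ha.2, hξ.1]⟩),
          ← ENNReal.ofReal_mul (Real.rpow_nonneg (by linarith) _), ← ENNReal.ofReal_mul hC0]
        exact ENNReal.ofReal_le_ofReal (integrand_le hp hξ.1.le ⟨h1, ha.2⟩ h2)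
    _ ≤ ∫⁻ ξ, ∫⁻ a, ENNReal.ofReal C * (f (a - 2) * f (a - ξ)) :=
        (lintegral_mono fun ξ => setLIntegral_le_lintegral _ _).trans (setLIntegral_le_lintegral _ _)
    _ = ∫⁻ a, ∫⁻ ξ, ENNReal.ofReal C * (f (a - 2) * f (a - ξ)) := by
        refine lintegral_lintegral_swap (Measurable.aemeasurable ?_)
        change Measurable fun q : ℝ × ℝ => ENNReal.ofReal C * (f (q.2 - 2) * f (q.2 - q.1))
        fun_prop
    _ = ENNReal.ofReal C * ((∫⁻ u, f u) * ∫⁻ u, f u) := by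
        have h : ∀ a, ∫⁻ ξ, ENNReal.ofReal C * (f (a - 2) * f (a - ξ))
            = ENNReal.ofReal C * (f (a - 2) * ∫⁻ u, f u) := by
          intro a
          rw [lintegral_const_mul _ (by fun_prop), lintegral_const_mul _ (by fun_prop),
            lintegral_sub_left_eq_self]
        rw [lintegral_congr h, lintegral_const_mul _ (by fun_prop),
          lintegral_mul_const _ (by fun_prop), lintegral_sub_right_eq_self]
    _ < ∞ := ENNReal.mul_lt_top ENNReal.ofReal_lt_top (ENNReal.mul_lt_top hI hI)

/-- For `1 < ξ < 2`, the range `2 < a < 2 + (2 - ξ)` alone contributes at least `1 / (4 (2 - ξ))`,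
which is not integrable at `ξ = 2`. -/
lemma lintegral_density_cube : ∫⁻ x in strip 3, ENNReal.ofReal (density x) ^ (3 : ℝ) = ∞ := by
  rw [lintegral_density_rpow (by norm_num), ← top_le_iff]
  have htop : ∫⁻ ξ in Ioo (1 : ℝ) 2, ENNReal.ofReal (1 / 4 * ‖(ξ - 2)⁻¹‖) = ∞ := by
    by_contra h
    have hi : IntegrableOn (fun ξ : ℝ => (ξ - 2)⁻¹) (Ioc 1 2) := by
      refine ⟨by fun_prop, ?_⟩
      rw [hasFiniteIntegral_iff_norm, ← restrict_Ioo_eq_restrict_Ioc, lt_top_iff_ne_top]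
      intro h'
      apply h
      rw [lintegral_congr fun ξ => ENNReal.ofReal_mul (by norm_num : (0 : ℝ) ≤ 1 / 4),
        lintegral_const_mul _ (by fun_prop), h', ENNReal.mul_top]
      simp
    rw [← intervalIntegrable_iff_integrableOn_Ioc_of_le (by norm_num),
      intervalIntegrable_sub_inv_iff] at hi
    norm_num at hi
  rw [← htop]
  refine le_trans ?_ (lintegral_mono_set (Ioo_subset_Ioo zero_le_one (by norm_num : (2 : ℝ) ≤ 3)))
  refine setLIntegral_mono' measurableSet_Ioo fun ξ hξ => ?_
  have hδ : 0 < 2 - ξ := by linarith [hξ.2]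
  rw [max_eq_left hξ.2.le]
  calc ENNReal.ofReal (1 / 4 * ‖(ξ - 2)⁻¹‖)
      = ENNReal.ofReal (1 / 4 * (2 - ξ)⁻¹ ^ 2) * volume (Ioo (2 : ℝ) (2 + (2 - ξ))) := by
        rw [Real.volume_Ioo, ← ENNReal.ofReal_mul (by positivity), norm_inv, Real.norm_eq_abs,
          abs_sub_comm, abs_of_pos hδ]
        congr 1
        field_simp
        ring
    _ = ∫⁻ a in Ioo (2 : ℝ) (2 + (2 - ξ)), ENNReal.ofReal (1 / 4 * (2 - ξ)⁻¹ ^ 2) := by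
        rw [setLIntegral_const]
    _ ≤ ∫⁻ a in Ioo (2 : ℝ) (2 + (2 - ξ)),
          ENNReal.ofReal (jac ξ a * (rayMass ξ a / jac ξ a) ^ (3 : ℝ)) := by
        refine setLIntegral_mono' measurableSet_Ioo fun a ha => ENNReal.ofReal_le_ofReal ?_
        have hj := jac_pos ha.1.le (hξ.2.trans ha.1)
        -- On this range `(a - 2) + (a - ξ) < 3 (2 - ξ)`.
        have hle : jac ξ a ≤ 2 * (2 - ξ) := by
          have := jac_le ha.1.le (hξ.2.trans ha.1)
          linarith [ha.2]
        have hr := one_le_rayMass hξ.1.le ha.1.le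
        have e : jac ξ a * (rayMass ξ a / jac ξ a) ^ (3 : ℝ)
            = rayMass ξ a ^ 3 * (jac ξ a)⁻¹ ^ 2 := by
          rw [show (3 : ℝ) = (3 : ℕ) by norm_num, Real.rpow_natCast]
          field_simp
        rw [e]
        calc 1 / 4 * (2 - ξ)⁻¹ ^ 2 = 1 * (2 * (2 - ξ))⁻¹ ^ 2 := by
              field_simp; norm_num
          _ ≤ rayMass ξ a ^ 3 * (jac ξ a)⁻¹ ^ 2 := by
              gcongr
              exact one_le_pow₀ hr
    _ ≤ _ := lintegral_mono_set (Ioo_subset_Ioo_right (by linarith [hξ.1]))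

/-! ### From the integrals to membership in `L^p` -/

lemma isCompact_strip : IsCompact (strip 3) := by
  rw [← triangle_eq, triangle]
  exact (Set.toFinite _).isCompact_convexHull ℝ

/-- On a finite measure space `L^p ⊆ L^3` for `p ≥ 3`, including `p = ∞`, so divergence at the
exponent `3` excludes them all. -/
lemma memLp_density_iff {p : ℝ≥0∞} (hp : 1 ≤ p) :
    MemLp density p (volume.restrict (strip 3)) ↔ p < 3 := by
  have hfin : IsFiniteMeasure ((volume : Measure Plane).restrict (strip 3)) :=
    ⟨by rw [Measure.restrict_apply_univ]; exact isCompact_strip.measure_lt_top⟩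
  have hiff : ∀ q : ℝ≥0∞, q ≠ 0 → q ≠ ∞ → (MemLp density q (volume.restrict (strip 3)) ↔
      ∫⁻ x in strip 3, ENNReal.ofReal (density x) ^ q.toReal < ∞) := by
    intro q h0 hq
    rw [MemLp, eLpNorm_lt_top_iff_lintegral_rpow_enorm_lt_top h0 hq,
      and_iff_right measurable_density.aestronglyMeasurable]
    simp only [Real.enorm_of_nonneg (density_nonneg _)]
  constructor
  · intro h
    by_contra! h3
    have := (hiff 3 (by norm_num) (by norm_num)).1 (h.mono_exponent h3)
    rw [ENNReal.toReal_ofNat, lintegral_density_cube] at this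
    exact lt_irrefl _ this
  · intro h
    have hq : p ≠ ∞ := (h.trans (by norm_num)).ne
    rw [hiff p (by positivity) hq]
    refine lintegral_density_rpow_lt_top ?_ ?_
    · simpa using ENNReal.toReal_mono hq hp
    · simpa using ENNReal.toReal_strict_mono (by norm_num) h

/-- The density vanishes off the triangle, so the larger set is irrelevant; any other density of `σ`
agrees with it a.e. -/
lemma memLpOn_sigma_iff {p : ℝ≥0∞} (hp : 1 ≤ p) {S : Set Plane} (hS : MeasurableSet S)
    (hsub : strip 3 ⊆ S) : MemLpOn sigma p S ↔ p < 3 := by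
  have hind : (strip 3).indicator density = density := by
    ext x
    by_cases hx : x ∈ strip 3 <;> simp [hx, density]
  have h1 : MemLp density p (volume.restrict S) ↔ p < 3 := by
    rw [← memLp_density_iff hp, ← hind,
      memLp_indicator_iff_restrict (isClosed_strip 3).measurableSet,
      Measure.restrict_restrict (isClosed_strip 3).measurableSet,
      inter_eq_self_of_subset_left hsub, hind]
  have h2 : sigma.restrict S
      = (volume.restrict S).withDensity fun x => ENNReal.ofReal (density x) := by
    rw [sigma_eq, restrict_withDensity hS]
  rw [← h1]
  constructor
  · rintro ⟨g, hg0, hg, hgσ⟩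
    rw [h2, withDensity_eq_iff_of_sigmaFinite measurable_density.ennreal_ofReal.aemeasurable
      hg.1.aemeasurable.ennreal_ofReal] at hgσ
    refine hg.ae_eq ?_
    filter_upwards [hgσ] with x hx
    exact ((ENNReal.ofReal_eq_ofReal_iff (density_nonneg x) (hg0 x)).1 hx).symm
  · intro h
    exact ⟨density, density_nonneg, h, h2⟩

/-! ### Concentration near the corner of the target -/

/-- The rectangle `2 - r < ξ < 2`, `2 < a < 2 + √r` has area `r^(3/2)` and carries `rayMass ≥ 1`.
Both `slope a` and `a - ξ` are of order `√r` there, so the heights are of order `r`. -/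
lemma le_sigma_ball {r : ℝ} (hr : 0 < r) (hr1 : r < 1) :
    ENNReal.ofReal (r ^ (3 / 2 : ℝ)) ≤ sigma (Metric.ball !₂[2, 0] (2 * r)) := by
  have hs0 : 0 < √r := Real.sqrt_pos.2 hr
  have hsq : √r ^ 2 = r := Real.sq_sqrt hr.le
  have hs1 : √r < 1 := by nlinarith
  have hB : MeasurableSet (Metric.ball (!₂[2, 0] : Plane) (2 * r)) := Metric.isOpen_ball.measurableSet
  rw [← lintegral_indicator_one hB, lintegral_sigma (measurable_one.indicator hB)]
  calc ENNReal.ofReal (r ^ (3 / 2 : ℝ))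
      = ∫⁻ ξ in Ioo (2 - r) 2, ∫⁻ a in Ioo (2 : ℝ) (2 + √r), 1 := by
        rw [setLIntegral_const, setLIntegral_const, Real.volume_Ioo, Real.volume_Ioo, one_mul,
          ← ENNReal.ofReal_mul (by linarith)]
        congr 1
        rw [show (3 / 2 : ℝ) = 1 / 2 + 1 by norm_num, Real.rpow_add hr, Real.rpow_one,
          ← Real.sqrt_eq_rpow]
        ring
    _ ≤ ∫⁻ ξ in Ioo (2 - r) 2, ∫⁻ a in Ioo (max 2 ξ) 3, ENNReal.ofReal (rayMass ξ a) *
          (Metric.ball (!₂[2, 0] : Plane) (2 * r)).indicator 1 !₂[ξ, height ξ a] := by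
        refine setLIntegral_mono' measurableSet_Ioo fun ξ hξ => ?_
        rw [max_eq_left hξ.2.le]
        refine le_trans ?_ (lintegral_mono_set (Ioo_subset_Ioo_right
          (by linarith : 2 + √r ≤ 3)))
        refine setLIntegral_mono' measurableSet_Ioo fun a ha => ?_
        have hmem : (!₂[ξ, height ξ a] : Plane) ∈ Metric.ball (!₂[2, 0] : Plane) (2 * r) := by
          have hsl : slope a ≤ 2 / 3 * √r := by
            rw [slope, div_le_iff₀ (by linarith [ha.1])]
            nlinarith [ha.1, ha.2]
          have hh : height ξ a ≤ 4 / 3 * r := by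
            have h2 : a - ξ ≤ 2 * √r := by nlinarith [ha.2, hξ.1]
            calc height ξ a ≤ (2 / 3 * √r) * (2 * √r) :=
                  mul_le_mul hsl h2 (by linarith [ha.1, hξ.2]) (by positivity)
              _ = 4 / 3 * √r ^ 2 := by ring
              _ = 4 / 3 * r := by rw [hsq]
          have hh0 := height_nonneg ha.1.le (hξ.2.trans ha.1).le
          -- The bounds `r` and `4r/3` on the two coordinates give distance at most `5r/3 < 2r`.
          rw [Metric.mem_ball, dist_target (mem_targetSegment.2 (by norm_num))]
          simp only [Matrix.cons_val_zero, Matrix.cons_val_one]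
          rw [Real.sqrt_lt' (by linarith)]
          have h5 : (2 - ξ) ^ 2 ≤ r ^ 2 :=
            pow_le_pow_left₀ (by linarith [hξ.2]) (by linarith [hξ.1]) 2
          have h6 : height ξ a ^ 2 ≤ (4 / 3 * r) ^ 2 := pow_le_pow_left₀ hh0 hh 2
          nlinarith
        rw [indicator_of_mem hmem, Pi.one_apply, mul_one, ← ENNReal.ofReal_one]
        exact ENNReal.ofReal_le_ofReal (one_le_rayMass (by linarith [hξ.1]) ha.1.le)
    _ ≤ _ := lintegral_mono_set (Ioo_subset_Ioo (by linarith) (by norm_num))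

/-- A bounded density would give the ball mass `O(r²)`, which is smaller than `r^(3/2)` for small
`r`. -/
lemma not_memLpOn_top {U : Set Plane} (hU : IsOpen U) (hmem : !₂[2, 0] ∈ U) :
    ¬ MemLpOn sigma ∞ U := by
  rintro ⟨g, hg0, hg, hgσ⟩
  obtain ⟨ε, hε, hball⟩ := Metric.isOpen_iff.1 hU _ hmem
  obtain ⟨M, hM⟩ : ∃ M : ℝ, ∀ᵐ x ∂volume.restrict U, g x ≤ M := by
    refine ⟨(eLpNormEssSup g (volume.restrict U)).toReal, ?_⟩
    have hfin : eLpNormEssSup g (volume.restrict U) ≠ ∞ := by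
      have := hg.2; rw [eLpNorm_exponent_top] at this; exact this.ne
    filter_upwards [ae_le_eLpNormEssSup (f := g) (μ := volume.restrict U)] with x hx
    have := ENNReal.toReal_mono hfin hx
    rw [Real.enorm_of_nonneg (hg0 x), ENNReal.toReal_ofReal (hg0 x)] at this
    exact this
  set V : ℝ := (volume (Metric.ball (0 : Plane) 1)).toReal with hV
  have hVfin : volume (Metric.ball (0 : Plane) 1) ≠ ∞ := measure_ball_lt_top.ne
  have key : ∀ r : ℝ, 0 < r → r < 1 → 2 * r ≤ ε → r ^ (3 / 2 : ℝ) ≤ |M| * ((2 * r) ^ 2 * V) := by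
    intro r hr hr1 hrε
    have hsub : Metric.ball (!₂[2, 0] : Plane) (2 * r) ⊆ U :=
      (Metric.ball_subset_ball hrε).trans hball
    have h := le_sigma_ball hr hr1
    rw [← inter_eq_self_of_subset_left hsub,
      ← Measure.restrict_apply Metric.isOpen_ball.measurableSet, hgσ,
      withDensity_apply _ Metric.isOpen_ball.measurableSet,
      Measure.restrict_restrict Metric.isOpen_ball.measurableSet,
      inter_eq_self_of_subset_left hsub] at h
    have h2 : ∫⁻ x in Metric.ball (!₂[2, 0] : Plane) (2 * r), ENNReal.ofReal (g x)
        ≤ ∫⁻ x in Metric.ball (!₂[2, 0] : Plane) (2 * r), ENNReal.ofReal |M| := by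
      refine lintegral_mono_ae ?_
      filter_upwards [ae_restrict_of_ae_restrict_of_subset hsub hM] with x hx
      exact ENNReal.ofReal_le_ofReal (hx.trans (le_abs_self M))
    have h3 := h.trans h2
    rw [setLIntegral_const, Measure.addHaar_ball _ _ (by linarith), finrank_euclideanSpace_fin,
      ← ENNReal.ofReal_toReal hVfin, ← ENNReal.ofReal_mul (by positivity),
      ← ENNReal.ofReal_mul (by positivity)] at h3
    exact (ENNReal.ofReal_le_ofReal_iff (by positivity)).1 h3
  have htend : Filter.Tendsto (fun r : ℝ => |M| * (4 * √r * V)) (nhdsWithin 0 (Ioi 0)) (nhds 0) := by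
    have : Continuous fun r : ℝ => |M| * (4 * √r * V) := by fun_prop
    simpa using this.tendsto' 0 0 (by simp) |>.mono_left nhdsWithin_le_nhds
  have hev : ∀ᶠ r : ℝ in nhdsWithin 0 (Ioi 0), r < min 1 (ε / 2) :=
    nhdsWithin_le_nhds (Iio_mem_nhds (by positivity))
  obtain ⟨r, ⟨h1, h2⟩, h3⟩ :=
    ((htend.eventually (gt_mem_nhds one_pos)).and hev |>.and self_mem_nhdsWithin).exists
  have hr : 0 < r := h3
  obtain ⟨h4, h5⟩ := lt_min_iff.1 h2
  have h6 := key r hr h4 (by linarith)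
  rw [show (3 / 2 : ℝ) = 1 / 2 + 1 by norm_num, Real.rpow_add hr, Real.rpow_one,
    ← Real.sqrt_eq_rpow] at h6
  have hs0 : 0 < √r := Real.sqrt_pos.2 hr
  have hsq : √r * √r = r := Real.mul_self_sqrt hr.le
  have h7 : √r * r * 1 ≤ √r * r * (|M| * (4 * √r * V)) := by
    calc √r * r * 1 ≤ |M| * ((2 * r) ^ 2 * V) := by linarith
      _ = |M| * (4 * r * V) * (√r * √r) := by rw [hsq]; ring
      _ = _ := by ring
  exact absurd (le_of_mul_le_mul_left h7 (by positivity)) (not_le.2 h1)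

/-! ### Admissible domains -/

lemma isAdmissibleDomain_triangle : IsAdmissibleDomain triangle := by
  rw [triangle_eq]
  refine ⟨isCompact_strip, convex_strip 3, ?_, fun y hy => ?_⟩
  · rw [trapezoid_eq]
    exact fun x hx => ⟨⟨hx.1.1, hx.1.2.trans (by norm_num)⟩, hx.2⟩
  · obtain ⟨⟨h1, h2⟩, h3⟩ := mem_targetSegment.1 hy
    refine ⟨subset_closure ⟨⟨by linarith, h2⟩, h3.ge, by rw [h3]; linarith⟩, fun hint => ?_⟩
    obtain ⟨ε, hε, hball⟩ := Metric.isOpen_iff.1 isOpen_interior y hint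
    have hz : (!₂[y 0, -(ε / 2)] : Plane) ∈ Metric.ball y ε := by
      rw [Metric.mem_ball, dist_target hy]
      simp only [Matrix.cons_val_zero, Matrix.cons_val_one]
      rw [Real.sqrt_lt' hε]
      nlinarith
    have h4 : (0 : ℝ) ≤ -(ε / 2) := (interior_subset (hball hz)).2.1
    linarith

/-- Two vertices of `Δ₁` lie in `A`, and `(3, 0)` belongs to the boundary of the closed set `Ω`;
convexity does the rest. -/
lemma strip_subset_of_isAdmissibleDomain {Ω : Set Plane} (hΩ : IsAdmissibleDomain Ω) :
    strip 3 ⊆ Ω := by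
  obtain ⟨hc, hconv, hA, hT⟩ := hΩ
  rw [← triangle_eq]
  refine convexHull_min ?_ hconv
  rintro x (rfl | rfl | rfl)
  · exact hA (subset_convexHull ℝ _ (by simp))
  · exact hc.isClosed.frontier_subset (hT (right_mem_segment ℝ _ _))
  · exact hA (subset_convexHull ℝ _ (by simp))

lemma hasLpDensity_restrict {μ : Measure Plane} {S T : Set Plane} (hS : MeasurableSet S)
    (hST : S ⊆ T) : HasLpDensity (μ.restrict S) (μ.restrict T) ∞ := by
  refine ⟨S.indicator 1, fun x => indicator_nonneg (fun _ _ => zero_le_one) x,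
    memLp_top_of_bound (measurable_one.indicator hS).aestronglyMeasurable 1
      (Filter.Eventually.of_forall fun x => ?_), ?_⟩
  · by_cases hx : x ∈ S <;> simp [hx]
  · have : (fun x => ENNReal.ofReal (S.indicator (1 : Plane → ℝ) x)) = S.indicator 1 := by
      ext x
      by_cases hx : x ∈ S <;> simp [hx]
    rw [this, withDensity_indicator_one hS, Measure.restrict_restrict hS,
      inter_eq_self_of_subset_left hST]

end TransportCounterexample

open TransportCounterexample in
theorem mainTheorem6 :
    fPlus univ = 1 ∧ fMinus univ = 1 ∧
    (∃ Ω : Set Plane, IsAdmissibleDomain Ω) ∧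
    (∀ Ω : Set Plane, IsAdmissibleDomain Ω →
      HasLpDensity fPlus (volume.restrict Ω) ∞ ∧
      HasLpDensity fMinus ((Measure.hausdorffMeasure 1).restrict (frontier Ω)) ∞) ∧
    ∃ σ : Measure Plane,
      (∀ σ' : Measure Plane, IsTransportDensity fPlus fMinus σ' ↔ σ' = σ) ∧
      (∃ C : ℝ, 0 < C ∧ ∃ r₀ : ℝ, 0 < r₀ ∧ ∀ r : ℝ, 0 < r → r < r₀ →
        ENNReal.ofReal (C * r ^ (3 / 2 : ℝ)) ≤ σ (Metric.ball !₂[2, 0] (2 * r))) ∧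
      (∀ U : Set Plane, IsOpen U → !₂[2, 0] ∈ U → ¬ MemLpOn σ ∞ U) ∧
      ¬ MemLpOn σ ∞ triangle ∧
      ¬ MemLpOn σ 4 triangle ∧
      (∀ p : ℝ≥0∞, 1 ≤ p → (MemLpOn σ p triangle ↔ p < 3)) ∧
      (∀ Ω : Set Plane, IsAdmissibleDomain Ω → ∀ p : ℝ≥0∞, 1 ≤ p →
        (MemLpOn σ p Ω ↔ p < 3)) := by
  have htri : ∀ p : ℝ≥0∞, 1 ≤ p → (MemLpOn sigma p triangle ↔ p < 3) := fun p hp => by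
    rw [triangle_eq]
    exact memLpOn_sigma_iff hp (isClosed_strip 3).measurableSet Subset.rfl
  refine ⟨fPlus_univ, fMinus_univ, ⟨_, isAdmissibleDomain_triangle⟩, fun Ω hΩ => ⟨?_, ?_⟩,
    sigma, fun σ' => isTransportDensity_iff, ⟨1, one_pos, 1, one_pos, fun r hr hr1 => ?_⟩,
    fun U hU hmem => not_memLpOn_top hU hmem, ?_, ?_, htri, fun Ω hΩ p hp => ?_⟩
  · exact hasLpDensity_restrict measurableSet_trapezoid hΩ.2.2.1
  · exact hasLpDensity_restrict isClosed_targetSegment.measurableSet hΩ.2.2.2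
  · rw [one_mul]
    exact le_sigma_ball hr hr1
  · rw [htri ∞ le_top]
    exact not_top_lt
  · rw [htri 4 (by norm_num)]
    norm_num
  · exact memLpOn_sigma_iff hp hΩ.1.isClosed.measurableSet
      (strip_subset_of_isAdmissibleDomain hΩ)
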